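/- Let $q$ be a prime power and let $h\ge 0$ be an integer. For subspaces $U,V$ of $\mathbb F_q^n$ put $d_S(U,V)=\dim(U+V)-\dim(U\cap V)$. An $(n,d,\{k\})_q$ constant dimension code (CDC) is a nonempty set of $k$-dimensional subspaces of $\mathbb F_q^n$ any two distinct members of which have subspace distance $d_S$ at least $d$; $A_q(n,d,\{k\})$ denotes the maximum cardinality of such a code. Let $\begin{bmatrix}n\\k\end{bmatrix}_q=\prod_{i=0}^{k-1}\frac{q^n-q^i}{q^k-q^i}$, and for an integer $S\ge 1$ let $$N_q(8,2,4;S)=\left\lfloor\frac{\begin{bmatrix}8\\3\end{bmatrix}_q-S\begin{bmatrix}4\\1\end{bmatrix}_q}{\sum_{i=0}^{1}q^{i^2}\begin{bmatrix}3\\i\end{bmatrix}_q\begin{bmatrix}5\\i\end{bmatrix}_q}\right\rfloor .$$ Then, for $S=A_q(8,4,\{4\})$ and, more generally, for every cardinality $S$ of an $(8,4,\{4\})_q$ CDC (for instance the best-known one), $$\begin{aligned}A_q(18+h,4,\{4\})\ \ge\ & S\,q^{30+3h}+N_q(8,2,4;S)\,q^{27+3h}\\&+S\left(1+(q^{10+h}-1)(q^2+1)(q^2+q+1)\right)\\&+N_q(8,2,4;S)\left(1+(q^{9+h}-1)(q^2+1)(q^2+q+1)\right)\\&+\sum_{i=0}^{2}\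 \sum_{j=0}^{\min\{3,\lfloor (5+h)/2\rfloor\}}q^{\min\{7-2i,\;7-2j+h\}+14+h-2i-2j}.\end{aligned}$$ -/

import Mathlib

/-- The subspace distance `d_S(U, V) = dim (U + V) - dim (U ∩ V)`.  The subtraction in `ℕ` is never
truncated, since `U ∩ V ⊆ U + V`. -/
noncomputable def subspaceDist {F : Type*} [Field F] {n : ℕ}
    (U V : Submodule F (Fin n → F)) : ℕ :=
  Module.finrank F ↥(U ⊔ V) - Module.finrank F ↥(U ⊓ V)

/-- An `(n, d, {k})_q` constant dimension code over `F = 𝔽_q`: a nonempty set of `k`-dimensional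
subspaces of `F ^ n`, any two distinct members of which have subspace distance at least `d`. -/
def IsCDC {F : Type*} [Field F] (n d k : ℕ) (C : Set (Submodule F (Fin n → F))) : Prop :=
  C.Nonempty ∧ (∀ U ∈ C, Module.finrank F ↥U = k) ∧
    ∀ U ∈ C, ∀ V ∈ C, U ≠ V → d ≤ subspaceDist U V

/-- `A_q(n, d, {k})`: the largest cardinality of an `(n, d, {k})_q` constant dimension code over the
finite field `F = 𝔽_q`. -/
noncomputable def maxCDC (F : Type*) [Field F] (n d k : ℕ) : ℕ :=
  sSup {M : ℕ | ∃ C : Set (Submodule F (Fin n → F)), IsCDC n d k C ∧ C.ncard = M}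

/-- The `q`-ary Gaussian binomial coefficient `∏_{i < k} (q ^ n - q ^ i) / (q ^ k - q ^ i)`. -/
def gaussBinom (q n k : ℕ) : ℚ :=
  ∏ i ∈ Finset.range k, ((q : ℚ) ^ n - (q : ℚ) ^ i) / ((q : ℚ) ^ k - (q : ℚ) ^ i)

/-- The greedy count `N_q(x, y, z)` (for `1 ≤ y ≤ z` and `z - y + 1 ≤ x`), formed with an
`(x, S, 2y, {z})_q` constant dimension code: the integer part of
`([x, z-y+1]_q - S [z, y-1]_q) / ∑_{i=0}^{y-1} q^(i^2) [z-y+1, i]_q [x-(z-y+1), i]_q`. -/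
def greedyCount (q x y z S : ℕ) : ℤ :=
  ⌊(gaussBinom q x (z - y + 1) - (S : ℚ) * gaussBinom q z (y - 1)) /
    ∑ i ∈ Finset.range y,
      (q : ℚ) ^ (i ^ 2) * gaussBinom q (z - y + 1) i * gaussBinom q (x - (z - y + 1)) i⌋

/-- The bound for length `18 + h` built from an `(8, S, 4, {4})_q` constant dimension code.  In the
double sum `i ≤ 2` and `j ≤ 3`, so no subtraction in the exponents is truncated. -/
def cdcBound (q h S : ℕ) : ℤ :=
  (S : ℤ) * (q : ℤ) ^ (30 + 3 * h)
    + greedyCount q 8 2 4 S * (q : ℤ) ^ (27 + 3 * h)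
    + (S : ℤ) * (1 + ((q : ℤ) ^ (10 + h) - 1) * ((q : ℤ) ^ 2 + 1) * ((q : ℤ) ^ 2 + q + 1))
    + greedyCount q 8 2 4 S *
        (1 + ((q : ℤ) ^ (9 + h) - 1) * ((q : ℤ) ^ 2 + 1) * ((q : ℤ) ^ 2 + q + 1))
    + ∑ i ∈ Finset.range 3, ∑ j ∈ Finset.range (min 3 ((5 + h) / 2) + 1),
        (q : ℤ) ^ (min (7 - 2 * i) (7 + h - 2 * j) + (14 + h - 2 * i - 2 * j))

open Module Submodule

universe u v

/-! ### Counting subspaces of a finite vector space. -/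

section Counting

variable {F : Type*} [Field F] {V : Type*} [AddCommGroup V] [Module F V] [Finite V]

/-! Two 4-spaces are at distance at least 4 exactly when they meet in dimension at most 2. Split the
ambient space as `(E × F) × (H × (F × E))` with `dim E = 8` and `dim H = h`; let `π` project to the
left block `E × F` and `σ` to the right one. The code is a union of four families.

`S₁` lifts the members of the given code `C` in `E` by a rank-metric code with values in the
remaining `10 + h` coordinates. `S₂` lifts the 4-spaces `W × F`, where `W` runs over a greedy family
`T` of 3-spaces of `E` that lie in no member of `C` and pairwise meet in dimension at most 1
(`exists_greedy_threeSpaces`); here `9 + h` coordinates remain. Members of `S₁` and `S₂` project to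
`E` inside a codeword and inside some `W` respectively, so they meet in dimension at most 2. The
members of `S₁ ∪ S₂` are all disjoint from `ker π`.

The third family mirrors those members whose image under `σ` has dimension at most 2. Its images
under `π` then have dimension at most 2, and since `π` is injective on members of `S₁ ∪ S₂`,
intersections with them are small. Its size comes from the codewords of rank at most 2 in the
rank-metric code (`exists_rankCode`).

The fourth family consists of products of a 2-space on the left with a 2-space on the right, taken
from matched partial parallelisms (`exists_lines`, `exists_middle_packing`). Both projections have
dimension 2, so it is compatible with the first two families through `π` and with the third through
`σ`. -/

theorem natCard_linearIndependent [Finite F] {k : ℕ} (hk : k ≤ finrank F V) :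
    Nat.card {s : Fin k → V // LinearIndependent F s} =
      ∏ i ∈ Finset.range k, (Nat.card F ^ finrank F V - Nat.card F ^ i) := by
  have := Fintype.ofFinite F
  rw [card_linearIndependent hk, Finset.prod_range, Nat.card_eq_fintype_card]

/-- Sort the independent `k`-tuples of `V` by their span: each `k`-space is the span of precisely
its own ordered bases. -/
theorem natCard_submodule_finrank_mul [Finite F] {k : ℕ} (hk : k ≤ finrank F V) :
    Nat.card {K : Submodule F V // finrank F K = k} *
        ∏ i ∈ Finset.range k, (Nat.card F ^ k - Nat.card F ^ i) =
      ∏ i ∈ Finset.range k, (Nat.card F ^ finrank F V - Nat.card F ^ i) := by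
  classical
  rw [← natCard_linearIndependent hk]
  have := Fintype.ofFinite {K : Submodule F V // finrank F K = k}
  let φ : (Σ K : {K : Submodule F V // finrank F K = k},
      {s : Fin k → K.1 // LinearIndependent F s}) → {s : Fin k → V // LinearIndependent F s} :=
    fun x => ⟨fun i => (x.2.1 i : V), x.2.2.map' x.1.1.subtype (ker_subtype _)⟩
  have hspan : ∀ x, span F (Set.range (φ x).1) = x.1.1 := by
    rintro ⟨⟨K, hK⟩, s, hs⟩
    apply eq_of_le_of_finrank_eq
    · rw [span_le]
      rintro _ ⟨i, rfl⟩
      exact (s i).2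
    · rw [finrank_span_eq_card (φ ⟨⟨K, hK⟩, s, hs⟩).2, Fintype.card_fin]
      exact hK.symm
  have hφ : Function.Bijective φ := by
    constructor
    · rintro ⟨⟨K, hK⟩, s, hs⟩ ⟨⟨K', hK'⟩, s', hs'⟩ hh
      have h1 := hspan ⟨⟨K, hK⟩, s, hs⟩
      have h2 := hspan ⟨⟨K', hK'⟩, s', hs'⟩
      rw [hh, h2] at h1
      obtain rfl : K' = K := h1
      obtain rfl : s = s' := by
        funext i
        exact Subtype.ext (congrFun (congrArg Subtype.val hh) i)
      rfl
    · rintro ⟨s, hs⟩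
      exact ⟨⟨⟨span F (Set.range s), by simpa using finrank_span_eq_card hs⟩,
        fun i => ⟨s i, subset_span ⟨i, rfl⟩⟩, LinearIndependent.of_comp (Submodule.subtype _) hs⟩,
        rfl⟩
  rw [← Nat.card_congr (Equiv.ofBijective φ hφ), Nat.card_sigma]
  have : ∀ K : {K : Submodule F V // finrank F K = k},
      Nat.card {s : Fin k → K.1 // LinearIndependent F s} =
        ∏ i ∈ Finset.range k, (Nat.card F ^ k - Nat.card F ^ i) := by
    rintro ⟨K, rfl⟩
    exact natCard_linearIndependent le_rfl
  simp [this]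

theorem natCard_submodule_finrank [Finite F] {k : ℕ} (hk : k ≤ finrank F V) :
    (Nat.card {K : Submodule F V // finrank F K = k} : ℚ) =
      gaussBinom (Nat.card F) (finrank F V) k := by
  have hq : 1 < Nat.card F := Finite.one_lt_card
  have key := congrArg (Nat.cast : ℕ → ℚ) (natCard_submodule_finrank_mul (F := F) (V := V) hk)
  have cast : ∀ n, k ≤ n → ((∏ i ∈ Finset.range k, (Nat.card F ^ n - Nat.card F ^ i) : ℕ) : ℚ) =
      ∏ i ∈ Finset.range k, ((Nat.card F : ℚ) ^ n - (Nat.card F : ℚ) ^ i) := by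
    intro n hn
    rw [Nat.cast_prod]
    refine Finset.prod_congr rfl fun i hi => ?_
    rw [Nat.cast_sub (Nat.pow_le_pow_right hq.le ((Finset.mem_range.1 hi).le.trans hn))]
    push_cast
    rfl
  rw [Nat.cast_mul, cast _ le_rfl, cast _ hk] at key
  rw [gaussBinom, Finset.prod_div_distrib, ← key, mul_div_cancel_right₀]
  refine Finset.prod_ne_zero_iff.2 fun i hi => sub_ne_zero.2 (ne_of_gt ?_)
  exact_mod_cast Nat.pow_lt_pow_right hq (Finset.mem_range.1 hi)

theorem natCard_submodule_le_le {k : ℕ} (U : Submodule F V) :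
    Nat.card {W : Submodule F V // finrank F W = k ∧ W ≤ U} ≤
      Nat.card {W : Submodule F U // finrank F W = k} := by
  refine Nat.card_le_card_of_injective
    (fun W => ⟨W.1.comap U.subtype, ?_⟩) fun W W' hh => Subtype.ext ?_
  · exact (Submodule.comapSubtypeEquivOfLe W.2.2).finrank_eq.trans W.2.1
  · have := congrArg (fun X => Submodule.map U.subtype X.1) hh
    simpa [Submodule.map_comap_subtype, W.2.2, W'.2.2] using this

theorem natCard_notMem (W : Submodule F V) :
    Nat.card {v : V // v ∉ W} = Nat.card F ^ finrank F V - Nat.card F ^ finrank F W := by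
  rw [← natCard_eq_pow_finrank (K := F) (V := V), ← natCard_eq_pow_finrank (K := F) (V := W)]
  exact Set.ncard_compl (W : Set V)

/-- Count pairs of an admissible `W'` and a vector `v` in `W'` outside `P`. Such a `v` avoids `W`,
and it determines `W'` as the span of `P` and `v`. -/
theorem natCard_submodule_inf_eq_le [Finite F] {n k : ℕ} (W P : Submodule F V) (hV : finrank F V = n)
    (hP : finrank F P = k) :
    Nat.card {W' : Submodule F V // finrank F W' = k + 1 ∧ W ⊓ W' = P} *
      (Nat.card F ^ (k + 1) - Nat.card F ^ k) ≤ Nat.card F ^ n - Nat.card F ^ finrank F W := by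
  classical
  have hV' : Nat.card {v : V // v ∉ W} = Nat.card F ^ n - Nat.card F ^ finrank F W :=
    hV ▸ natCard_notMem W
  have := Fintype.ofFinite {W' : Submodule F V // finrank F W' = k + 1 ∧ W ⊓ W' = P}
  have hfib : ∀ W' : {W' : Submodule F V // finrank F W' = k + 1 ∧ W ⊓ W' = P},
      Nat.card {v : W'.1 // v ∉ P.comap W'.1.subtype} = Nat.card F ^ (k + 1) - Nat.card F ^ k := by
    rintro ⟨W', h1, h2⟩
    have h3 : P ≤ W' := h2.ge.trans inf_le_right
    have h4 := (Submodule.comapSubtypeEquivOfLe h3).finrank_eq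
    exact (natCard_notMem _).trans (by rw [h4, hP, h1])
  have hsig : Nat.card (Σ W' : {W' : Submodule F V // finrank F W' = k + 1 ∧ W ⊓ W' = P},
      {v : W'.1 // v ∉ P.comap W'.1.subtype}) =
      Nat.card {W' : Submodule F V // finrank F W' = k + 1 ∧ W ⊓ W' = P} *
      (Nat.card F ^ (k + 1) - Nat.card F ^ k) := by
    rw [Nat.card_sigma, Finset.sum_congr rfl fun W' _ => hfib W', Finset.sum_const, smul_eq_mul,
      Finset.card_univ, ← Nat.card_eq_fintype_card]
  rw [← hsig, ← hV']
  refine Nat.card_le_card_of_injective (fun x => ⟨(x.2.1 : V), ?_⟩) ?_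
  · obtain ⟨⟨W', h1, h2⟩, v, hv⟩ := x
    intro hvW
    exact hv (h2.le ⟨hvW, v.2⟩)
  · have hspan : ∀ x : (Σ W' : {W' : Submodule F V // finrank F W' = k + 1 ∧ W ⊓ W' = P},
        {v : W'.1 // v ∉ P.comap W'.1.subtype}), x.1.1 = P ⊔ span F {(x.2.1 : V)} := by
      rintro ⟨⟨W', h1, h2⟩, v, hv⟩
      have h3 : P ≤ W' := h2.ge.trans inf_le_right
      symm
      apply eq_of_le_of_finrank_le
      · exact sup_le h3 (by simp)
      · have hlt : P < P ⊔ span F {(v : V)} := by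
          refine lt_of_le_of_ne le_sup_left fun he => hv ?_
          change (v : V) ∈ P
          refine he.ge ?_
          exact mem_sup_right (mem_span_singleton_self _)
        have := finrank_lt_finrank_of_lt hlt
        change finrank F W' ≤ _
        dsimp only
        omega
    rintro ⟨⟨W', h1⟩, v, hv⟩ ⟨⟨W'', h2⟩, v', hv'⟩ hh
    have hvv : (v : V) = v' := congrArg Subtype.val hh
    have e1 := hspan ⟨⟨W', h1⟩, v, hv⟩
    have e2 := hspan ⟨⟨W'', h2⟩, v', hv'⟩
    dsimp only at e1 e2
    rw [hvv, ← e2] at e1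
    obtain rfl := e1
    obtain rfl := Subtype.ext hvv
    rfl

end Counting

/-! ### Greedy selection and small Gaussian coefficients. -/

/-- A pairwise compatible subset of maximum size cannot be enlarged, so the conflict balls around
its members cover `G`. -/
theorem exists_greedy {α : Type*} (G : Finset α) (r : α → α → Prop) (hr : ∀ a b, r a b → r b a)
    (b : ℕ) (hb : ∀ w ∈ G, {w' | w' ∈ G ∧ (w' = w ∨ ¬ r w w')}.ncard ≤ b) :
    ∃ T ⊆ G, (∀ w ∈ T, ∀ w' ∈ T, w ≠ w' → r w w') ∧ G.card ≤ T.card * b := by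
  classical
  obtain ⟨T, hT, hmax⟩ := Finset.exists_max_image
    (G.powerset.filter fun T => ∀ w ∈ T, ∀ w' ∈ T, w ≠ w' → r w w') Finset.card ⟨∅, by simp⟩
  simp only [Finset.mem_filter, Finset.mem_powerset] at hT hmax
  refine ⟨T, hT.1, hT.2, ?_⟩
  have hsub : G ⊆ T.biUnion fun w => G.filter fun w' => w' = w ∨ ¬ r w w' := by
    intro x hx
    by_contra hcon
    simp only [Finset.mem_biUnion, Finset.mem_filter, not_exists, not_and, not_or, not_not] at hcon
    have hxT : x ∉ T := fun hxT => (hcon x hxT hx).1 rfl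
    have := hmax (insert x T) ⟨Finset.insert_subset hx hT.1, by
      intro w hw w' hw' hne
      rw [Finset.mem_insert] at hw hw'
      rcases hw with rfl | hw <;> rcases hw' with rfl | hw'
      · exact absurd rfl hne
      · exact hr _ _ (hcon w' hw' hx).2
      · exact (hcon _ hw hx).2
      · exact hT.2 w hw w' hw' hne⟩
    rw [Finset.card_insert_of_notMem hxT] at this
    omega
  refine (Finset.card_le_card hsub).trans (Finset.card_biUnion_le_card_mul _ _ _ fun w hw => ?_)
  rw [← Set.ncard_coe_finset]
  simpa using hb w (hT.1 hw)

theorem gaussBinom_three_two {q : ℕ} (hq : 1 < q) : gaussBinom q 3 2 = (q : ℚ) ^ 2 + q + 1 := by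
  have h1 : (1 : ℚ) < q := by exact_mod_cast hq
  have h2 : (q : ℚ) - 1 ≠ 0 := by linarith
  have h0 : (q : ℚ) ≠ 0 := by linarith
  have h3 : (q : ℚ) + 1 ≠ 0 := by linarith
  rw [gaussBinom, Finset.prod_range_succ, Finset.prod_range_one]
  rw [show (q : ℚ) ^ 3 - q ^ 0 = (q - 1) * (q ^ 2 + q + 1) by ring,
    show (q : ℚ) ^ 2 - q ^ 0 = (q - 1) * (q + 1) by ring,
    show (q : ℚ) ^ 3 - q ^ 1 = q * (q - 1) * (q + 1) by ring,
    show (q : ℚ) ^ 2 - q ^ 1 = q * (q - 1) by ring]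
  field_simp

theorem gaussBinom_four_two {q : ℕ} (hq : 1 < q) :
    gaussBinom q 4 2 = ((q : ℚ) ^ 2 + 1) * (q ^ 2 + q + 1) := by
  have h1 : (1 : ℚ) < q := by exact_mod_cast hq
  have h2 : (q : ℚ) - 1 ≠ 0 := by linarith
  have h0 : (q : ℚ) ≠ 0 := by linarith
  have h3 : (q : ℚ) + 1 ≠ 0 := by linarith
  rw [gaussBinom, Finset.prod_range_succ, Finset.prod_range_one]
  rw [show (q : ℚ) ^ 4 - q ^ 0 = (q - 1) * (q + 1) * (q ^ 2 + 1) by ring,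
    show (q : ℚ) ^ 2 - q ^ 0 = (q - 1) * (q + 1) by ring,
    show (q : ℚ) ^ 4 - q ^ 1 = q * (q - 1) * (q ^ 2 + q + 1) by ring,
    show (q : ℚ) ^ 2 - q ^ 1 = q * (q - 1) by ring]
  field_simp

theorem gaussBinom_four_three {q : ℕ} (hq : 1 < q) : gaussBinom q 4 3 = gaussBinom q 4 1 := by
  have h1 : (1 : ℚ) < q := by exact_mod_cast hq
  have h2 : (q : ℚ) - 1 ≠ 0 := by linarith
  have h0 : (q : ℚ) ≠ 0 := by linarith
  have h3 : (q : ℚ) + 1 ≠ 0 := by linarith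
  have h4 : (q : ℚ) ^ 2 + q + 1 ≠ 0 := by positivity
  rw [gaussBinom, gaussBinom, Finset.prod_range_succ, Finset.prod_range_succ, Finset.prod_range_one,
    Finset.prod_range_one]
  rw [show (q : ℚ) ^ 4 - q ^ 0 = (q - 1) * (q + 1) * (q ^ 2 + 1) by ring,
    show (q : ℚ) ^ 3 - q ^ 0 = (q - 1) * (q ^ 2 + q + 1) by ring,
    show (q : ℚ) ^ 4 - q ^ 1 = q * (q - 1) * (q ^ 2 + q + 1) by ring,
    show (q : ℚ) ^ 3 - q ^ 1 = q * (q - 1) * (q + 1) by ring,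
    show (q : ℚ) ^ 4 - q ^ 2 = q ^ 2 * (q - 1) * (q + 1) by ring,
    show (q : ℚ) ^ 3 - q ^ 2 = q ^ 2 * (q - 1) by ring,
    show (q : ℚ) ^ 1 - q ^ 0 = q - 1 by ring]
  field_simp

theorem ball_sum_eq {q : ℕ} (hq : 1 < q) :
    ∑ i ∈ Finset.range 2, (q : ℚ) ^ (i ^ 2) * gaussBinom q 3 i * gaussBinom q 5 i =
      ((1 + (q ^ 2 + q + 1) * (q * (q ^ 4 + q ^ 3 + q ^ 2 + q + 1)) : ℕ) : ℚ) := by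
  have h1 : (1 : ℚ) < q := by exact_mod_cast hq
  have h2 : (q : ℚ) - 1 ≠ 0 := by linarith
  simp only [gaussBinom, Finset.sum_range_succ, Finset.sum_range_zero, Finset.prod_range_zero,
    Finset.prod_range_one]
  rw [show (q : ℚ) ^ 3 - q ^ 0 = (q - 1) * (q ^ 2 + q + 1) by ring,
    show (q : ℚ) ^ 5 - q ^ 0 = (q - 1) * (q ^ 4 + q ^ 3 + q ^ 2 + q + 1) by ring,
    show (q : ℚ) ^ 1 - q ^ 0 = q - 1 by ring, mul_div_cancel_left₀ _ h2, mul_div_cancel_left₀ _ h2]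
  push_cast
  ring

/-! ### The greedy family of 3-spaces in dimension 8. -/

section ThreeSpaces

variable {F : Type*} [Field F] [Finite F]

/-- Classify `W'` by the plane `P = W ⊓ W'`. There are `q ^ 2 + q + 1` planes in `W`, and each
arises from at most `(q ^ 8 - q ^ 3) / (q ^ 3 - q ^ 2)` spaces `W'`. -/
theorem ncard_three_inf_two_le {V : Type*} [AddCommGroup V] [Module F V] [Finite V]
    (hV : finrank F V = 8) (W : Submodule F V) (hW : finrank F W = 3) :
    {W' : Submodule F V | finrank F W' = 3 ∧ finrank F ↥(W ⊓ W') = 2}.ncard ≤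
      (Nat.card F ^ 2 + Nat.card F + 1) *
        (Nat.card F * (Nat.card F ^ 4 + Nat.card F ^ 3 + Nat.card F ^ 2 + Nat.card F + 1)) := by
  classical
  have hq : 1 < Nat.card F := Finite.one_lt_card
  have hfib : ∀ P : Submodule F V, finrank F P = 2 →
      Nat.card {W' : Submodule F V // finrank F W' = 3 ∧ W ⊓ W' = P} ≤
        Nat.card F * (Nat.card F ^ 4 + Nat.card F ^ 3 + Nat.card F ^ 2 + Nat.card F + 1) := by
    intro P hP
    have := natCard_submodule_inf_eq_le W P hV hP
    rw [hW] at this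
    -- Writing `q = p + 1` turns the truncated differences into products, so that the common factor
    -- `q ^ 2 * (q - 1)` cancels.
    obtain ⟨p, hp⟩ : ∃ p, Nat.card F = p + 1 := ⟨Nat.card F - 1, by omega⟩
    rw [hp] at this hq ⊢
    rw [show (p + 1) ^ (2 + 1) - (p + 1) ^ 2 = (p + 1) ^ 2 * p from
        Nat.sub_eq_of_eq_add (by ring),
      show (p + 1) ^ 8 - (p + 1) ^ 3 =
        ((p + 1) * ((p + 1) ^ 4 + (p + 1) ^ 3 + (p + 1) ^ 2 + (p + 1) + 1)) * ((p + 1) ^ 2 * p) from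
        Nat.sub_eq_of_eq_add (by ring)] at this
    exact Nat.le_of_mul_le_mul_right this (mul_pos (by positivity) (by omega))
  have hcard : Nat.card {P : Submodule F V // finrank F P = 2 ∧ P ≤ W} ≤
      Nat.card F ^ 2 + Nat.card F + 1 := by
    refine (natCard_submodule_le_le W).trans (le_of_eq ?_)
    have := natCard_submodule_finrank (F := F) (V := W) (k := 2) (by omega)
    rw [hW, gaussBinom_three_two hq] at this
    exact_mod_cast this
  have := Fintype.ofFinite {P : Submodule F V // finrank F P = 2 ∧ P ≤ W}
  rw [← Nat.card_coe_set_eq]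
  calc Nat.card {W' : Submodule F V | finrank F W' = 3 ∧ finrank F ↥(W ⊓ W') = 2}
      ≤ Nat.card (Σ P : {P : Submodule F V // finrank F P = 2 ∧ P ≤ W},
          {W' : Submodule F V // finrank F W' = 3 ∧ W ⊓ W' = P.1}) := by
        refine Nat.card_le_card_of_injective
          (fun W' => ⟨⟨W ⊓ W'.1, W'.2.2, inf_le_left⟩, ⟨W'.1, W'.2.1, rfl⟩⟩) fun W' W'' hh => ?_
        have := congrArg (fun x : (Σ P : {P : Submodule F V // finrank F P = 2 ∧ P ≤ W},
          {W' : Submodule F V // finrank F W' = 3 ∧ W ⊓ W' = P.1}) => x.2.1) hh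
        exact Subtype.ext this
    _ ≤ ∑ _P : {P : Submodule F V // finrank F P = 2 ∧ P ≤ W},
          Nat.card F * (Nat.card F ^ 4 + Nat.card F ^ 3 + Nat.card F ^ 2 + Nat.card F + 1) := by
        rw [Nat.card_sigma]
        exact Finset.sum_le_sum fun P _ => hfib P.1 P.2.1
    _ ≤ _ := by
        rw [Finset.sum_const, smul_eq_mul, Finset.card_univ, ← Nat.card_eq_fintype_card]
        exact Nat.mul_le_mul_right _ hcard

/-- Each member of `C` excludes at most `[4, 3] = [4, 1]` of the `[8, 3]` 3-spaces. Greedy selection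
among the rest loses one conflict ball per chosen space, and the ball size is the denominator of
`greedyCount`. -/
theorem exists_greedy_threeSpaces (C : Set (Submodule F (Fin 8 → F)))
    (hC : ∀ U ∈ C, finrank F U = 4) :
    ∃ T : Set (Submodule F (Fin 8 → F)), (∀ W ∈ T, finrank F W = 3) ∧
      (∀ W ∈ T, ∀ W' ∈ T, W ≠ W' → finrank F ↥(W ⊓ W') ≤ 1) ∧
      (∀ W ∈ T, ∀ U ∈ C, finrank F ↥(W ⊓ U) ≤ 2) ∧
      greedyCount (Nat.card F) 8 2 4 C.ncard ≤ T.ncard := by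
  classical
  have hq : 1 < Nat.card F := Finite.one_lt_card
  have := Fintype.ofFinite (Submodule F (Fin 8 → F))
  have h8 : finrank F (Fin 8 → F) = 8 := by simp
  set b := 1 + (Nat.card F ^ 2 + Nat.card F + 1) *
    (Nat.card F * (Nat.card F ^ 4 + Nat.card F ^ 3 + Nat.card F ^ 2 + Nat.card F + 1)) with hb
  let A : Finset (Submodule F (Fin 8 → F)) := Finset.univ.filter fun W => finrank F W = 3
  let G := A.filter fun W => ∀ U ∈ C, ¬ W ≤ U
  obtain ⟨T, hTG, hT, hcard⟩ := exists_greedy G (fun W W' => finrank F ↥(W ⊓ W') ≤ 1)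
    (fun W W' hh => by rwa [inf_comm]) b (by
      intro W hW
      have hW3 : finrank F W = 3 := by simp only [G, A, Finset.mem_filter] at hW; exact hW.1.2
      have hsub : {W' | W' ∈ G ∧ (W' = W ∨ ¬ finrank F ↥(W ⊓ W') ≤ 1)} ⊆
          insert W {W' | finrank F W' = 3 ∧ finrank F ↥(W ⊓ W') = 2} := by
        rintro W' ⟨hG, hW'⟩
        by_cases he : W' = W
        · exact Or.inl he
        · right
          have h3 : finrank F W' = 3 := by simp only [G, A, Finset.mem_filter] at hG; exact hG.1.2
          refine ⟨h3, ?_⟩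
          have h1 := hW'.resolve_left he
          have h2 : finrank F ↥(W ⊓ W') < 3 := by
            rw [← hW3]
            refine finrank_lt_finrank_of_lt (lt_of_le_of_ne inf_le_left fun hh => he ?_)
            exact (eq_of_le_of_finrank_eq (inf_eq_left.1 hh) (hW3.trans h3.symm)).symm
          omega
      refine (Set.ncard_le_ncard hsub (Set.toFinite _)).trans ((Set.ncard_insert_le _ _).trans ?_)
      have := ncard_three_inf_two_le h8 W hW3
      omega)
  have hmem : ∀ W ∈ T, finrank F W = 3 ∧ ∀ U ∈ C, ¬ W ≤ U := by
    intro W hW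
    have := hTG hW
    simp only [G, A, Finset.mem_filter] at this
    exact ⟨this.1.2, this.2⟩
  refine ⟨T, fun W hW => (hmem W hW).1, hT, fun W hW U hU => ?_, ?_⟩
  · have h3 := (hmem W hW).1
    have : finrank F ↥(W ⊓ U) < finrank F W :=
      finrank_lt_finrank_of_lt
        (lt_of_le_of_ne inf_le_left fun hh => (hmem W hW).2 U hU (inf_eq_left.1 hh))
    omega
  · have hA : (A.card : ℚ) = gaussBinom (Nat.card F) 8 3 := by
      have := natCard_submodule_finrank (F := F) (V := Fin 8 → F) (k := 3) (by omega)
      rw [h8] at this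
      rw [← this, Nat.card_eq_fintype_card, Fintype.card_subtype]
    have hU : ∀ U ∈ C, ((A.filter fun W => W ≤ U).card : ℚ) ≤ gaussBinom (Nat.card F) 4 1 := by
      intro U hU
      have h1 := natCard_submodule_finrank (F := F) (V := U) (k := 3) (by rw [hC U hU]; omega)
      rw [hC U hU, gaussBinom_four_three hq] at h1
      rw [← h1]
      have h2 := natCard_submodule_le_le (k := 3) U
      rw [Nat.card_eq_fintype_card, Fintype.card_subtype, ← Finset.filter_filter] at h2
      exact_mod_cast h2
    have hAG : A ⊆ G ∪ C.toFinset.biUnion fun U => A.filter fun W => W ≤ U := by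
      intro W hW
      by_cases hh : ∀ U ∈ C, ¬ W ≤ U
      · exact Finset.mem_union_left _ (Finset.mem_filter.2 ⟨hW, hh⟩)
      · push Not at hh
        obtain ⟨U, hU, hWU⟩ := hh
        exact Finset.mem_union_right _ (Finset.mem_biUnion.2
          ⟨U, by simpa using hU, Finset.mem_filter.2 ⟨hW, hWU⟩⟩)
    have h1 : (A.card : ℚ) ≤ G.card + C.ncard * gaussBinom (Nat.card F) 4 1 := by
      have h2 := (Finset.card_le_card hAG).trans (Finset.card_union_le _ _)
      have h3 : ((C.toFinset.biUnion fun U => A.filter fun W => W ≤ U).card : ℚ) ≤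
          C.ncard * gaussBinom (Nat.card F) 4 1 := by
        calc ((C.toFinset.biUnion fun U => A.filter fun W => W ≤ U).card : ℚ)
            ≤ ∑ U ∈ C.toFinset, ((A.filter fun W => W ≤ U).card : ℚ) := by
              exact_mod_cast Finset.card_biUnion_le
          _ ≤ ∑ U ∈ C.toFinset, gaussBinom (Nat.card F) 4 1 :=
              Finset.sum_le_sum fun U hU' => hU U (by simpa using hU')
          _ = _ := by rw [Finset.sum_const, nsmul_eq_mul, Set.ncard_eq_toFinset_card']
      have h4 : (A.card : ℚ) ≤
          G.card + (C.toFinset.biUnion fun U => A.filter fun W => W ≤ U).card := by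
        exact_mod_cast h2
      linarith
    have hcard' : (G.card : ℚ) ≤ T.card * (b : ℚ) := by exact_mod_cast hcard
    have hbpos : (0 : ℚ) < b := by
      have : 0 < b := by omega
      exact_mod_cast this
    rw [greedyCount]
    simp only [Nat.reduceSub, Nat.reduceAdd]
    rw [ball_sum_eq hq, ← hb, Set.ncard_coe_finset]
    have h5 : (gaussBinom (Nat.card F) 8 3 - (C.ncard : ℚ) * gaussBinom (Nat.card F) 4 1) / b ≤
        T.card := by
      rw [div_le_iff₀ hbpos]
      linarith
    exact_mod_cast (Int.floor_le _).trans h5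

end ThreeSpaces

/-! ### A rank-metric code and its codewords of rank at most 2. -/

section RankCode

variable {F : Type u} [Field F] [Finite F]

theorem exists_field_extension_finrank (F : Type u) [Field F] [Finite F] {m : ℕ} (hm : m ≠ 0) :
    ∃ (L : Type) (_ : Field L) (_ : Algebra F L), Module.Finite F L ∧ finrank F L = m := by
  obtain ⟨p, hp⟩ := CharP.exists F
  have : Fact p.Prime := ⟨CharP.char_is_prime F p⟩
  have : NeZero m := ⟨hm⟩
  exact ⟨FiniteField.Extension F p m, inferInstance, inferInstance, inferInstance,
    FiniteField.finrank_extension F p m⟩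

/-- Pairing a linear map on `F ^ 4` with four elements of an extension field. -/
noncomputable def checkMap {L G : Type*} [Field L] [Algebra F L] [AddCommGroup G] [Module F G]
    (e : G →ₗ[F] L) (α : Fin 4 → L) : ((Fin 4 → F) →ₗ[F] G) →ₗ[F] L :=
  ∑ i, LinearMap.mulLeft F (α i) ∘ₗ e ∘ₗ LinearMap.applyₗ (Pi.single i (1 : F))

omit [Finite F] in
theorem checkMap_apply {L G : Type*} [Field L] [Algebra F L] [AddCommGroup G] [Module F G]
    (e : G →ₗ[F] L) (α : Fin 4 → L) (f : (Fin 4 → F) →ₗ[F] G) :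
    checkMap e α f = ∑ i, α i * e (f (Pi.single i 1)) := by
  simp [checkMap, LinearMap.sum_apply]

omit [Finite F] in
-- If `f` had rank 1, with image spanned by `y`, then `f` would send the basis vectors to `c i • y`,
-- and the check would read `(∑ i, c i • α i) * e y = 0`, contradicting the independence of `α`.
theorem finrank_ker_le_two_of_checkMap_eq_zero {L G : Type*} [Field L] [Algebra F L]
    [AddCommGroup G] [Module F G] {e : G →ₗ[F] L} (he : Function.Injective e) {α : Fin 4 → L}
    (hα : LinearIndependent F α) {f : (Fin 4 → F) →ₗ[F] G} (hf : checkMap e α f = 0)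
    (hf0 : f ≠ 0) : finrank F (LinearMap.ker f) ≤ 2 := by
  by_contra! hcon
  have hrn := f.finrank_range_add_finrank_ker
  simp only [finrank_fintype_fun_eq_card, Fintype.card_fin] at hrn
  obtain ⟨⟨y, hy⟩, hspan⟩ := finrank_le_one_iff.1 (show finrank F (LinearMap.range f) ≤ 1 by omega)
  have hc : ∀ i, ∃ c : F, c • y = f (Pi.single i 1) := fun i => by
    obtain ⟨c, hc⟩ := hspan ⟨f (Pi.single i 1), ⟨_, rfl⟩⟩
    exact ⟨c, congrArg Subtype.val hc⟩
  choose c hc using hc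
  have hy0 : e y ≠ 0 := by
    intro h0
    have : y = 0 := he (by rw [h0, map_zero])
    apply hf0
    refine LinearMap.pi_ext' fun i => LinearMap.ext_ring ?_
    simp [← hc, this]
  have hsum : (∑ i, c i • α i) * e y = 0 := by
    rw [← hf, checkMap_apply, Finset.sum_mul]
    refine Finset.sum_congr rfl fun i _ => ?_
    rw [← hc, map_smul, mul_smul_comm, smul_mul_assoc]
  have hc0 := Fintype.linearIndependent_iff.1 hα c ((mul_eq_zero.1 hsum).resolve_right hy0)
  apply hf0
  refine LinearMap.pi_ext' fun i => LinearMap.ext_ring ?_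
  simp [← hc, hc0]

omit [Finite F] in
theorem comp_mkQ_injective {A G : Type*} [AddCommGroup A] [Module F A] [AddCommGroup G]
    [Module F G] (K : Submodule F A) :
    Function.Injective fun g : (A ⧸ K) →ₗ[F] G => g ∘ₗ K.mkQ :=
  fun _ _ hh => (LinearMap.cancel_right K.mkQ_surjective).1 hh

/-- The maps on the quotient by `K` whose lifts to `F ^ 4` pair to zero with `α`. -/
noncomputable def checkQuotient {L G : Type*} [Field L] [Algebra F L] [AddCommGroup G] [Module F G]
    (e : G →ₗ[F] L) (α : Fin 4 → L) (K : Submodule F (Fin 4 → F)) :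
    Submodule F (((Fin 4 → F) ⧸ K) →ₗ[F] G) :=
  LinearMap.ker (checkMap e α ∘ₗ LinearMap.lcomp F G K.mkQ)

omit [Finite F] in
theorem mem_checkQuotient {L G : Type*} [Field L] [Algebra F L] [AddCommGroup G] [Module F G]
    {e : G →ₗ[F] L} {α : Fin 4 → L} {K : Submodule F (Fin 4 → F)}
    {g : ((Fin 4 → F) ⧸ K) →ₗ[F] G} :
    g ∈ checkQuotient e α K ↔ checkMap e α (g ∘ₗ K.mkQ) = 0 := Iff.rfl

omit [Finite F] in
-- The maps from the 2-dimensional quotient to `G` form a space of dimension `2 * m`, and the check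
-- imposes at most `m` linear conditions.
theorem le_finrank_checkQuotient {L G : Type*} [Field L] [Algebra F L] [Module.Finite F L]
    [AddCommGroup G] [Module F G] [Module.Finite F G] {m : ℕ} (hG : finrank F G = m)
    (hL : finrank F L = m) (e : G →ₗ[F] L) (α : Fin 4 → L) {K : Submodule F (Fin 4 → F)}
    (hK : finrank F K = 2) : m ≤ finrank F (checkQuotient e α K) := by
  have h1 := (checkMap e α ∘ₗ LinearMap.lcomp F G K.mkQ).finrank_range_add_finrank_ker
  have h2 := finrank_le (LinearMap.range (checkMap e α ∘ₗ LinearMap.lcomp F G K.mkQ))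
  have h3 := finrank_quotient_add_finrank K
  rw [finrank_fintype_fun_eq_card, Fintype.card_fin, hK] at h3
  rw [Module.finrank_linearMap, hG, show finrank F ((Fin 4 → F) ⧸ K) = 2 by omega] at h1
  have h4 : m ≤ finrank F
      (LinearMap.ker (checkMap e α ∘ₗ LinearMap.lcomp F G K.mkQ)) := by omega
  exact h4

omit [Finite F] in
theorem ker_comp_mkQ_of_mem_checkQuotient {L G : Type*} [Field L] [Algebra F L]
    [AddCommGroup G] [Module F G] {e : G →ₗ[F] L} (he : Function.Injective e) {α : Fin 4 → L}
    (hα : LinearIndependent F α) {K : Submodule F (Fin 4 → F)} (hK : finrank F K = 2)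
    {g : ((Fin 4 → F) ⧸ K) →ₗ[F] G} (hg : g ∈ checkQuotient e α K) (hg0 : g ≠ 0) :
    LinearMap.ker (g ∘ₗ K.mkQ) = K := by
  symm
  apply eq_of_le_of_finrank_le
  · intro v hv
    simp [(Submodule.Quotient.mk_eq_zero _).2 hv]
  · rw [hK]
    exact finrank_ker_le_two_of_checkMap_eq_zero he hα (mem_checkQuotient.1 hg)
      fun h0 => hg0 (comp_mkQ_injective K (h0.trans (LinearMap.zero_comp _).symm))

/-- A nonzero codeword vanishing on a 2-space `K` has kernel exactly `K`. So different 2-spaces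
contribute disjoint sets, each of at least `q ^ m - 1` codewords; the zero map is the extra one. -/
theorem natCard_lowRank_le {L G : Type*} [Field L] [Algebra F L] [Module.Finite F L]
    [AddCommGroup G] [Module F G] [Finite G] {m : ℕ} (hG : finrank F G = m)
    (hL : finrank F L = m) {e : G →ₗ[F] L} (he : Function.Injective e) {α : Fin 4 → L}
    (hα : LinearIndependent F α) :
    1 + (Nat.card F ^ m - 1) * ((Nat.card F ^ 2 + 1) * (Nat.card F ^ 2 + Nat.card F + 1)) ≤
      Nat.card {f : (Fin 4 → F) →ₗ[F] G //
        checkMap e α f = 0 ∧ finrank F (LinearMap.range f) ≤ 2} := by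
  classical
  have hq : 1 < Nat.card F := Finite.one_lt_card
  have : Finite ((Fin 4 → F) →ₗ[F] G) := Module.finite_of_finite F
  have hFin : ∀ K : Submodule F (Fin 4 → F), Finite (((Fin 4 → F) ⧸ K) →ₗ[F] G) :=
    fun K => Module.finite_of_finite F
  have hN : ∀ K : Submodule F (Fin 4 → F), finrank F K = 2 →
      Nat.card F ^ m - 1 ≤ Nat.card {g // g ∈ checkQuotient e α K ∧ g ≠ 0} := by
    intro K hK
    have h1 := natCard_notMem (⊥ : Submodule F (checkQuotient e α K))
    rw [finrank_bot, pow_zero] at h1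
    refine (Nat.sub_le_sub_right (Nat.pow_le_pow_right hq.le
      (le_finrank_checkQuotient hG hL e α hK)) _).trans (h1.ge.trans ?_)
    exact Nat.card_le_card_of_injective
      (fun g => ⟨g.1.1, g.1.2, fun h0 => g.2 ((mem_bot F).2 (Subtype.ext h0))⟩)
      fun g g' hh => by
        have h2 := Subtype.ext_iff.1 hh
        exact Subtype.ext (Subtype.ext h2)
  let I := Σ K : {K : Submodule F (Fin 4 → F) // finrank F K = 2},
    {g // g ∈ checkQuotient e α K.1 ∧ g ≠ 0}
  have hker : ∀ x : I, LinearMap.ker (x.2.1 ∘ₗ x.1.1.mkQ) = x.1.1 := fun x =>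
    ker_comp_mkQ_of_mem_checkQuotient he hα x.1.2 x.2.2.1 x.2.2.2
  have hne : ∀ x : I, x.2.1 ∘ₗ x.1.1.mkQ ≠ 0 := fun x h0 =>
    x.2.2.2 (comp_mkQ_injective x.1.1 (h0.trans (LinearMap.zero_comp _).symm))
  have : Fintype {K : Submodule F (Fin 4 → F) // finrank F K = 2} := Fintype.ofFinite _
  have hI : (Nat.card F ^ m - 1) * ((Nat.card F ^ 2 + 1) * (Nat.card F ^ 2 + Nat.card F + 1)) ≤
      Nat.card I := by
    have hcard := natCard_submodule_finrank (F := F) (V := Fin 4 → F) (k := 2) (by simp)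
    rw [finrank_fintype_fun_eq_card, Fintype.card_fin, gaussBinom_four_two hq] at hcard
    have hcard' : Nat.card {K : Submodule F (Fin 4 → F) // finrank F K = 2} =
      (Nat.card F ^ 2 + 1) * (Nat.card F ^ 2 + Nat.card F + 1) := by exact_mod_cast hcard
    rw [Nat.card_sigma, ← hcard', mul_comm,
      Nat.card_eq_fintype_card (α := {K : Submodule F (Fin 4 → F) // finrank F K = 2}),
      ← smul_eq_mul, ← Finset.card_univ, ← Finset.sum_const]
    exact Finset.sum_le_sum fun K _ => hN K.1 K.2
  have hrank : ∀ x : I, finrank F (LinearMap.range (x.2.1 ∘ₗ x.1.1.mkQ)) ≤ 2 := by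
    intro x
    have h1 := (x.2.1 ∘ₗ x.1.1.mkQ).finrank_range_add_finrank_ker
    rw [hker x, x.1.2, finrank_fintype_fun_eq_card, Fintype.card_fin] at h1
    omega
  -- `none` stands for the zero map.
  calc _ ≤ Nat.card (Option I) := by rw [Finite.card_option]; omega
    _ ≤ _ := by
      refine Nat.card_le_card_of_injective (fun o => o.elim ⟨0, map_zero _, by rw [LinearMap.range_zero, finrank_bot]; omega⟩
        fun x => ⟨x.2.1 ∘ₗ x.1.1.mkQ, mem_checkQuotient.1 x.2.2.1, hrank x⟩) ?_
      rintro (_ | x) (_ | y) hxy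
      · rfl
      · exact absurd (congrArg Subtype.val hxy).symm (hne y)
      · exact absurd (congrArg Subtype.val hxy) (hne x)
      · have hxy' : x.2.1 ∘ₗ x.1.1.mkQ = y.2.1 ∘ₗ y.1.1.mkQ := congrArg Subtype.val hxy
        have h1 := hker x
        rw [hxy', hker y] at h1
        obtain ⟨⟨K, hK⟩, g, hg⟩ := x
        obtain ⟨⟨K', hK'⟩, g', hg'⟩ := y
        obtain rfl : K' = K := h1
        obtain rfl : g = g' := comp_mkQ_injective K' hxy'
        rfl

/-- The code is the kernel of `checkMap`, with `G` identified with an extension field of degree `m`;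
`4 ≤ m` leaves room for four independent elements `α`. -/
theorem exists_rankCode {G : Type*} [AddCommGroup G] [Module F G] [Finite G] {m : ℕ}
    (hG : finrank F G = m) (hm : 4 ≤ m) :
    ∃ M : Set ((Fin 4 → F) →ₗ[F] G),
      (∀ f ∈ M, ∀ g ∈ M, f ≠ g → finrank F (LinearMap.ker (f - g)) ≤ 2) ∧
      Nat.card F ^ (3 * m) ≤ M.ncard ∧
      1 + (Nat.card F ^ m - 1) * ((Nat.card F ^ 2 + 1) * (Nat.card F ^ 2 + Nat.card F + 1)) ≤
        {f | f ∈ M ∧ finrank F (LinearMap.range f) ≤ 2}.ncard := by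
  have hq : 1 < Nat.card F := Finite.one_lt_card
  obtain ⟨L, _, _, _, hL⟩ := exists_field_extension_finrank F (show m ≠ 0 by omega)
  let e : G ≃ₗ[F] L := LinearEquiv.ofFinrankEq _ _ (hG.trans hL.symm)
  obtain ⟨α, hα⟩ : ∃ α : Fin 4 → L, LinearIndependent F α :=
    ⟨_, (finBasis F L).linearIndependent.comp (Fin.castLE (hL ▸ hm)) (Fin.castLE_injective _)⟩
  have : Finite ((Fin 4 → F) →ₗ[F] G) := Module.finite_of_finite F
  refine ⟨LinearMap.ker (checkMap e.toLinearMap α), fun f hf g hg hfg => ?_, ?_, ?_⟩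
  · exact finrank_ker_le_two_of_checkMap_eq_zero e.injective hα (sub_mem hf hg)
      (sub_ne_zero.2 hfg)
  · change _ ≤ Nat.card (LinearMap.ker _)
    rw [natCard_eq_pow_finrank (K := F) (V := LinearMap.ker _)]
    refine Nat.pow_le_pow_right hq.le ?_
    have h1 := (checkMap e.toLinearMap α).finrank_range_add_finrank_ker
    have h2 := finrank_le (LinearMap.range (checkMap e.toLinearMap α))
    rw [Module.finrank_linearMap, hG, finrank_fintype_fun_eq_card, Fintype.card_fin] at h1
    omega
  · exact natCard_lowRank_le hG hL e.injective hα

end RankCode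

/-! ### Partial parallelisms of 2-spaces. -/

section Lines

variable {F : Type u} [Field F]

theorem finrank_map_of_injective {A B : Type*} [AddCommGroup A] [Module F A] [AddCommGroup B]
    [Module F B] {f : A →ₗ[F] B} (hf : Function.Injective f) (S : Submodule F A) :
    finrank F (S.map f) = finrank F S :=
  (Submodule.equivMapOfInjective f hf S).finrank_eq.symm

theorem LinearMap.finrank_graph {A B : Type*} [AddCommGroup A] [Module F A] [AddCommGroup B]
    [Module F B] (f : A →ₗ[F] B) : finrank F f.graph = finrank F A := by
  rw [LinearMap.graph_eq_range_prod]
  exact LinearMap.finrank_range_of_inj fun x y hxy => congrArg Prod.fst hxy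

theorem LinearMap.finrank_graph_inf_graph {A B : Type*} [AddCommGroup A] [Module F A]
    [AddCommGroup B] [Module F B] [Module.Finite F A] (f g : A →ₗ[F] B) :
    finrank F ↥(f.graph ⊓ g.graph) ≤ finrank F (LinearMap.ker (f - g)) := by
  have hle : f.graph ⊓ g.graph ≤ (LinearMap.ker (f - g)).map (LinearMap.id.prod f) := by
    rintro ⟨a, b⟩ ⟨h1, h2⟩
    have h1' : b = f a := h1
    have h2' : b = g a := h2
    exact ⟨a, by simp [← h1', ← h2'], by simp [h1']⟩
  exact (finrank_mono hle).trans (finrank_map_le _ _)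

/-- A family of two-dimensional subspaces, indexed by a position `k`, a parallel class `y` and a
member `x` of that class: distinct positions give disjoint subspaces, and so do distinct members of
a class. -/
theorem exists_lines [Finite F] (K : ℕ) : ∀ (N : ℕ) (D : Type u) [AddCommGroup D] [Module F D]
    [Module.Finite F D], finrank F D = N → 2 * K + 2 ≤ N →
    ∃ A : ℕ → ℕ → ℕ → Submodule F D,
      (∀ k y x, k < K → finrank F (A k y x) = 2) ∧
      (∀ k y x k' y' x', k < K → k' < K → k ≠ k' → Disjoint (A k y x) (A k' y' x')) ∧
      (∀ k y x x', k < K → x < Nat.card F ^ (N - 2 * k - 2) → x' < Nat.card F ^ (N - 2 * k - 2) →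
        x ≠ x' → Disjoint (A k y x) (A k y x')) ∧
      (∀ k y x y' x', k < K → x < Nat.card F ^ (N - 2 * k - 2) →
        x' < Nat.card F ^ (N - 2 * k - 2) → y < Nat.card F ^ (N - 2 * k - 2) →
        y' < Nat.card F ^ (N - 2 * k - 2) → y ≠ y' → finrank F ↥(A k y x ⊓ A k y' x') ≤ 1) := by
  induction K with
  | zero => intro N D _ _ _ _ _; exact ⟨fun _ _ _ => ⊥, by simp, by simp, by simp, by simp⟩
  | succ K ih =>
    intro N D _ _ _ hD hN
    obtain ⟨a, rfl⟩ : ∃ a, N = a + 2 := ⟨N - 2, by omega⟩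
    obtain ⟨A, h1, h2, h3, h4⟩ := ih a (Fin a → F) (by simp) (by omega)
    obtain ⟨L, _, _, _, hL⟩ := exists_field_extension_finrank F (show a ≠ 0 by omega)
    have hLfin : Finite L := Module.finite_of_finite F
    -- Position 0 will consist of graphs of maps from `F × F` to `F ^ a`; the later positions are
    -- the inductive family placed inside `0 × F ^ a`, which every graph meets trivially.
    let e : ((F × F) × (Fin a → F)) ≃ₗ[F] D := LinearEquiv.ofFinrankEq _ _ (by
      rw [hD]; simp; omega)
    let ψ : L ≃ₗ[F] (Fin a → F) := LinearEquiv.ofFinrankEq _ _ (by rw [hL]; simp)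
    have hLcard : Nat.card L = Nat.card F ^ a := by rw [natCard_eq_pow_finrank (K := F), hL]
    -- An enumeration of `L`; the value 0 past its cardinality is never used where injectivity
    -- matters.
    let ξ : ℕ → L := fun n => if hn : n < Nat.card L then (Finite.equivFin L).symm ⟨n, hn⟩ else 0
    have hξ : ∀ n n', n < Nat.card F ^ a → n' < Nat.card F ^ a → ξ n = ξ n' → n = n' := by
      intro n n' hn hn' hh
      rw [← hLcard] at hn hn'
      simpa [ξ, hn, hn'] using hh
    -- Such an element exists because `2 ≤ a` makes `L` larger than `F`.
    obtain ⟨α, hα⟩ : ∃ α : L, ∀ c : F, algebraMap F L c ≠ α := by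
      by_contra! hcon
      have hbij : Function.Surjective (algebraMap F L) := hcon
      have hle := Nat.card_le_card_of_surjective _ hbij
      rw [hLcard] at hle
      have := Nat.pow_lt_pow_right (Finite.one_lt_card (α := F)) (show 1 < a by omega)
      rw [pow_one] at this
      omega
    -- Within a class `y`, two of these maps differ by `(c + d * α) * (ξ x - ξ x')`, which vanishes
    -- only at `c = d = 0` as `α` is not in `F`. Across classes the maps are still distinct, so
    -- their graphs share at most a 1-space.
    let g : ℕ → ℕ → (F × F) →ₗ[F] (Fin a → F) := fun y x =>
      ψ.toLinearMap ∘ₗ ((LinearMap.toSpanSingleton F L (ξ x)) ∘ₗ LinearMap.fst F F F +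
        (LinearMap.toSpanSingleton F L (α * ξ x + ξ y)) ∘ₗ LinearMap.snd F F F)
    have hg : ∀ y x c, g y x c = ψ (c.1 • ξ x + c.2 • (α * ξ x + ξ y)) := fun y x c => rfl
    have hmap : ∀ S T : Submodule F ((F × F) × (Fin a → F)), Disjoint S T →
        Disjoint (S.map e.toLinearMap) (T.map e.toLinearMap) := fun S T hST => by
      rw [disjoint_iff, ← Submodule.map_inf _ e.injective, hST.eq_bot, Submodule.map_bot]
    let B : ℕ → ℕ → ℕ → Submodule F ((F × F) × (Fin a → F)) := fun k y x =>
      Nat.casesOn k (g y x).graph fun k' => (A k' y x).map (LinearMap.inr F (F × F) (Fin a → F))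
    have hB0 : ∀ y x, B 0 y x = (g y x).graph := fun _ _ => rfl
    have hBs : ∀ k y x, B (k + 1) y x = (A k y x).map (LinearMap.inr F (F × F) (Fin a → F)) :=
      fun _ _ _ => rfl
    have hdis : ∀ k y x y' x', Disjoint (B 0 y x) (B (k + 1) y' x') := by
      intro k y x y' x'
      rw [hB0, hBs, Submodule.disjoint_def]
      rintro _ hv ⟨w, hw, rfl⟩
      have : w = g y x 0 := hv
      simp [this]
    refine ⟨fun k y x => (B k y x).map e.toLinearMap, ?_, ?_, ?_, ?_⟩
    · rintro (_ | k) y x hk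
      · rw [LinearEquiv.finrank_map_eq, hB0, LinearMap.finrank_graph]
        simp
      · rw [LinearEquiv.finrank_map_eq, hBs,
          finrank_map_of_injective LinearMap.inr_injective, h1 k y x (by omega)]
    · rintro (_ | k) y x (_ | k') y' x' hk hk' hne
      · exact absurd rfl hne
      · exact hmap _ _ (hdis _ _ _ _ _)
      · exact hmap _ _ (hdis _ _ _ _ _).symm
      · refine hmap _ _ ?_
        rw [hBs, hBs, disjoint_iff, ← Submodule.map_inf _ LinearMap.inr_injective,
          (h2 k y x k' y' x' (by omega) (by omega) (by omega)).eq_bot, Submodule.map_bot]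
    · rintro (_ | k) y x x' hk hx hx' hne
      · refine hmap _ _ ?_
        rw [hB0, hB0, Submodule.disjoint_def]
        rintro ⟨⟨c, d⟩, t⟩ ht ht'
        have ht1 : t = g y x (c, d) := ht
        have ht2 : t = g y x' (c, d) := ht'
        have h5 := ψ.injective ((hg y x (c, d)).symm.trans (ht1.symm.trans (ht2.trans (hg y x' (c, d)))))
        have h6 : (algebraMap F L c + algebraMap F L d * α) * (ξ x - ξ x') = 0 := by
          simp only [Algebra.smul_def] at h5
          linear_combination h5
        rcases mul_eq_zero.1 h6 with h7 | h7
        · have hd : d = 0 := by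
            by_contra hd
            refine hα (-c / d) ?_
            have : algebraMap F L d ≠ 0 := by simpa using hd
            rw [map_div₀, map_neg, div_eq_iff this]
            linear_combination -h7
          have hc : c = 0 := by simpa [hd] using h7
          rw [ht1, hc, hd]
          simp [hg]
        · exact absurd (hξ x x' (by simpa using hx) (by simpa using hx') (sub_eq_zero.1 h7)) hne
      · refine hmap _ _ ?_
        have he : a + 2 - 2 * (k + 1) - 2 = a - 2 * k - 2 := by omega
        rw [he] at hx hx'
        rw [hBs, hBs, disjoint_iff, ← Submodule.map_inf _ LinearMap.inr_injective,
          (h3 k y x x' (by omega) hx hx' hne).eq_bot, Submodule.map_bot]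
    · rintro (_ | k) y x y' x' hk hx hx' hy hy' hne
      · rw [← Submodule.map_inf _ e.injective, LinearEquiv.finrank_map_eq, hB0, hB0]
        refine (LinearMap.finrank_graph_inf_graph _ _).trans ?_
        have hlt : LinearMap.ker (g y x - g y' x') < ⊤ := by
          refine lt_top_iff_ne_top.2 fun htop => hne ?_
          have h5 : ∀ c, g y x c = g y' x' c := fun c => by
            have : c ∈ LinearMap.ker (g y x - g y' x') := htop ▸ mem_top
            simpa [sub_eq_zero] using this
          have h6 := ψ.injective (h5 (1, 0))
          have h7 := ψ.injective (h5 (0, 1))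
          simp only [LinearMap.add_apply, LinearMap.comp_apply, LinearMap.toSpanSingleton_apply,
            LinearMap.fst_apply, LinearMap.snd_apply, one_smul, zero_smul, add_zero, zero_add]
            at h6 h7
          rw [h6] at h7
          exact hξ y y' (by simpa using hy) (by simpa using hy') (add_left_cancel h7)
        have := finrank_lt_finrank_of_lt hlt
        rw [finrank_top, finrank_prod, finrank_self] at this
        omega
      · have he : a + 2 - 2 * (k + 1) - 2 = a - 2 * k - 2 := by omega
        rw [he] at hx hx' hy hy'
        rw [← Submodule.map_inf _ e.injective, LinearEquiv.finrank_map_eq, hBs, hBs,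
          ← Submodule.map_inf _ LinearMap.inr_injective,
          finrank_map_of_injective LinearMap.inr_injective]
        exact h4 k y x y' x' (by omega) hx hx' hy hy' hne

end Lines

/-! ### Packings of 4-spaces and their lifting. -/

section Packing

variable {F : Type*} [Field F]

/-- A set of four-dimensional subspaces that pairwise meet in dimension at most two. -/
def IsPacking {V : Type*} [AddCommGroup V] [Module F V] (S : Set (Submodule F V)) : Prop :=
  (∀ X ∈ S, finrank F X = 4) ∧ ∀ X ∈ S, ∀ Y ∈ S, X ≠ Y → finrank F ↥(X ⊓ Y) ≤ 2

variable {V W : Type*} [AddCommGroup V] [Module F V] [AddCommGroup W] [Module F W]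

theorem finrank_map_of_disjoint {p : V →ₗ[F] W} {X : Submodule F V}
    (hX : Disjoint X (LinearMap.ker p)) : finrank F (X.map p) = finrank F X := by
  rw [← LinearMap.range_domRestrict]
  refine LinearMap.finrank_range_of_inj (LinearMap.ker_eq_bot.1 ?_)
  rw [LinearMap.ker_eq_bot']
  rintro ⟨v, hv⟩ h0
  exact Subtype.ext (Submodule.disjoint_def.1 hX v hv h0)

theorem finrank_inf_le_map_inf_map [Module.Finite F W] {p : V →ₗ[F] W} {X : Submodule F V}
    (hX : Disjoint X (LinearMap.ker p)) (Y : Submodule F V) :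
    finrank F ↥(X ⊓ Y) ≤ finrank F ↥(X.map p ⊓ Y.map p) := by
  rw [← finrank_map_of_disjoint (hX.mono_left inf_le_left)]
  exact finrank_mono (map_inf_le p)

/-- This is the compatibility test between families: one member embeds under `p`, the other has a
small image. -/
theorem finrank_inf_le_finrank_map [Module.Finite F W] {p : V →ₗ[F] W} {X : Submodule F V}
    (hX : Disjoint X (LinearMap.ker p)) (Y : Submodule F V) :
    finrank F ↥(X ⊓ Y) ≤ finrank F (Y.map p) :=
  (finrank_inf_le_map_inf_map hX Y).trans (finrank_mono inf_le_right)

theorem IsPacking.subset {S T : Set (Submodule F V)} (hT : IsPacking T) (h : S ⊆ T) :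
    IsPacking S :=
  ⟨fun X hX => hT.1 X (h hX), fun X hX Y hY => hT.2 X (h hX) Y (h hY)⟩

theorem IsPacking.union {S T : Set (Submodule F V)} (hS : IsPacking S) (hT : IsPacking T)
    (hST : ∀ X ∈ S, ∀ Y ∈ T, finrank F ↥(X ⊓ Y) ≤ 2) : IsPacking (S ∪ T) := by
  refine ⟨fun X hX => hX.elim (hS.1 X) (hT.1 X), fun X hX Y hY hne => ?_⟩
  rcases hX with hX | hX <;> rcases hY with hY | hY
  · exact hS.2 X hX Y hY hne
  · exact hST X hX Y hY
  · rw [inf_comm]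
    exact hST Y hY X hX
  · exact hT.2 X hX Y hY hne

theorem IsPacking.disjoint {S T : Set (Submodule F V)} (hS : IsPacking S)
    (hST : ∀ X ∈ S, ∀ Y ∈ T, finrank F ↥(X ⊓ Y) ≤ 2) : Disjoint S T := by
  refine Set.disjoint_left.2 fun X hX hX' => ?_
  have h1 := hST X hX X hX'
  rw [inf_idem, hS.1 X hX] at h1
  omega

theorem IsPacking.ncard_union [Finite V] {S T : Set (Submodule F V)} (hS : IsPacking S)
    (hST : ∀ X ∈ S, ∀ Y ∈ T, finrank F ↥(X ⊓ Y) ≤ 2) :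
    (S ∪ T).ncard = S.ncard + T.ncard :=
  Set.ncard_union_eq (hS.disjoint hST) (Set.toFinite _) (Set.toFinite _)

theorem IsPacking.map_equiv {S : Set (Submodule F V)} (hS : IsPacking S) (e : V ≃ₗ[F] W) :
    IsPacking (Submodule.map e.toLinearMap '' S) := by
  constructor
  · rintro _ ⟨X, hX, rfl⟩
    rw [LinearEquiv.finrank_map_eq, hS.1 X hX]
  · rintro _ ⟨X, hX, rfl⟩ _ ⟨Y, hY, rfl⟩ hne
    rw [← Submodule.map_inf _ e.injective, LinearEquiv.finrank_map_eq]
    exact hS.2 X hX Y hY fun h => hne (h ▸ rfl)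

theorem ncard_image_map_equiv (S : Set (Submodule F V)) (e : V ≃ₗ[F] W) :
    (Submodule.map e.toLinearMap '' S).ncard = S.ncard :=
  Set.ncard_image_of_injective S (Submodule.map_injective_of_injective e.injective)

theorem isPacking_image {ι : Type*} {s : Set ι} {X : ι → Submodule F V}
    (h4 : ∀ i ∈ s, finrank F (X i) = 4)
    (h2 : ∀ i ∈ s, ∀ j ∈ s, i ≠ j → finrank F ↥(X i ⊓ X j) ≤ 2) :
    IsPacking (X '' s) ∧ Set.InjOn X s := by
  constructor
  · constructor
    · rintro _ ⟨i, hi, rfl⟩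
      exact h4 i hi
    · rintro _ ⟨i, hi, rfl⟩ _ ⟨j, hj, rfl⟩ hne
      exact h2 i hi j hj fun h => hne (h ▸ rfl)
  · intro i hi j hj hij
    by_contra hne
    have h1 := h2 i hi j hj hne
    rw [hij, inf_idem, h4 j hj] at h1
    omega

theorem le_maxCDC_of_isPacking [Finite F] {n : ℕ} {S : Set (Submodule F V)} (hS : IsPacking S)
    (hne : S.Nonempty) [Module.Finite F V] (hV : finrank F V = n) :
    S.ncard ≤ maxCDC F n 4 4 := by
  let e : V ≃ₗ[F] (Fin n → F) := LinearEquiv.ofFinrankEq _ _ (by simp [hV])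
  have hS' := hS.map_equiv e
  rw [← ncard_image_map_equiv S e]
  refine le_csSup ⟨Nat.card (Submodule F (Fin n → F)), ?_⟩ ⟨_, ⟨hne.image _, hS'.1, ?_⟩, rfl⟩
  · rintro _ ⟨C, -, rfl⟩
    exact Set.ncard_le_card C
  · intro X hX Y hY hXY
    have h1 := finrank_sup_add_finrank_inf_eq X Y
    have h2 := hS'.2 X hX Y hY hXY
    rw [hS'.1 X hX, hS'.1 Y hY] at h1
    rw [subspaceDist]
    omega

/-- Lifting four-dimensional subspaces by the maps of a rank-metric code. -/
theorem exists_lifted_packing [Finite F] {P G : Type*} [AddCommGroup P] [Module F P] [Finite P]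
    [AddCommGroup G] [Module F G] [Finite G] (ι : (P × G) ≃ₗ[F] V) {m : ℕ} (hG : finrank F G = m)
    (hm : 4 ≤ m) {U : Set (Submodule F P)} (hU : IsPacking U) :
    ∃ S : Set (Submodule F V), IsPacking S ∧
      (∀ X ∈ S, Disjoint X (LinearMap.ker (LinearMap.fst F P G ∘ₗ ι.symm.toLinearMap)) ∧
        X.map (LinearMap.fst F P G ∘ₗ ι.symm.toLinearMap) ∈ U) ∧
      U.ncard * Nat.card F ^ (3 * m) ≤ S.ncard ∧
      U.ncard * (1 + (Nat.card F ^ m - 1) *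
          ((Nat.card F ^ 2 + 1) * (Nat.card F ^ 2 + Nat.card F + 1))) ≤
        {X | X ∈ S ∧
          finrank F (X.map (LinearMap.snd F P G ∘ₗ ι.symm.toLinearMap)) ≤ 2}.ncard := by
  obtain ⟨M, hM, hcard, hlow⟩ := exists_rankCode hG hm
  have hHom : Finite ((Fin 4 → F) →ₗ[F] G) := Module.finite_of_finite F
  have hV : Finite V := Finite.of_equiv _ ι.toEquiv
  -- A parametrisation of each 4-space by `F ^ 4`; the zero map serves for other dimensions.
  have hβ : ∀ X : Submodule F P, ∃ β : (Fin 4 → F) →ₗ[F] P, finrank F X = 4 →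
      Function.Injective β ∧ LinearMap.range β = X := by
    intro X
    by_cases hX : finrank F X = 4
    · let e : (Fin 4 → F) ≃ₗ[F] X := LinearEquiv.ofFinrankEq _ _ (by simp [hX])
      refine ⟨X.subtype ∘ₗ e.toLinearMap, fun _ => ⟨X.injective_subtype.comp e.injective, ?_⟩⟩
      rw [LinearMap.range_comp, LinearEquiv.range, Submodule.map_top, Submodule.range_subtype]
    · exact ⟨0, fun h => absurd h hX⟩
  choose β hβ using hβ
  have hβi : ∀ X ∈ U, Function.Injective (β X) := fun X hX => (hβ X (hU.1 X hX)).1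
  have hβr : ∀ X ∈ U, LinearMap.range (β X) = X := fun X hX => (hβ X (hU.1 X hX)).2
  let L : Submodule F P × ((Fin 4 → F) →ₗ[F] G) → Submodule F V := fun x =>
    LinearMap.range (ι.toLinearMap ∘ₗ (β x.1).prod x.2)
  have hfst : ∀ x, (L x).map (LinearMap.fst F P G ∘ₗ ι.symm.toLinearMap) =
      LinearMap.range (β x.1) := by
    intro x
    rw [← LinearMap.range_comp]
    congr 1
    ext; all_goals simp
  have hsnd : ∀ x, (L x).map (LinearMap.snd F P G ∘ₗ ι.symm.toLinearMap) =
      LinearMap.range x.2 := by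
    intro x
    rw [← LinearMap.range_comp]
    congr 1
    ext; all_goals simp
  have hdis : ∀ x : Submodule F P × ((Fin 4 → F) →ₗ[F] G), x.1 ∈ U →
      Disjoint (L x) (LinearMap.ker (LinearMap.fst F P G ∘ₗ ι.symm.toLinearMap)) := by
    rintro x hx
    rw [Submodule.disjoint_def]
    rintro _ ⟨t, rfl⟩ ht
    have h0 : β x.1 t = 0 := by simpa using ht
    have : t = 0 := hβi x.1 hx (by rw [h0, map_zero])
    rw [this, map_zero]
  obtain ⟨hpack, hinj⟩ := isPacking_image (s := U ×ˢ M) (X := L) (by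
    rintro x ⟨hx, -⟩
    rw [← finrank_map_of_disjoint (hdis x hx), hfst, hβr _ hx, hU.1 _ hx]) (by
    rintro ⟨X, f⟩ ⟨hX, hf⟩ ⟨Y, g⟩ ⟨hY, hg⟩ hne
    -- Over the same base space, the intersection is governed by the kernel of `f - g`; over
    -- different ones, it embeds in the intersection of the bases.
    by_cases hXY : X = Y
    · subst hXY
      have hfg : f ≠ g := fun h => hne (h ▸ rfl)
      have hle : L (X, f) ⊓ L (X, g) ≤
          (LinearMap.ker (f - g)).map (ι.toLinearMap ∘ₗ (β X).prod f) := by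
        rintro _ ⟨⟨t, rfl⟩, ⟨t', ht'⟩⟩
        have h1 := ι.injective ht'
        have h2 : β X t' = β X t := congrArg Prod.fst h1
        have h3 : g t' = f t := congrArg Prod.snd h1
        obtain rfl := hβi X hX h2
        exact ⟨t', by simp [h3], rfl⟩
      exact (finrank_mono hle).trans ((finrank_map_le _ _).trans (hM f hf g hg hfg))
    · refine (finrank_inf_le_map_inf_map (hdis (X, f) hX) _).trans ?_
      rw [hfst, hfst, hβr _ hX, hβr _ hY]
      exact hU.2 X hX Y hY hXY)
  refine ⟨L '' (U ×ˢ M), hpack, ?_, ?_, ?_⟩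
  · rintro _ ⟨x, hx, rfl⟩
    exact ⟨hdis x hx.1, by rw [hfst, hβr _ hx.1]; exact hx.1⟩
  · rw [hinj.ncard_image, Set.ncard_prod]
    exact Nat.mul_le_mul_left _ hcard
  · refine (Nat.mul_le_mul_left _ hlow).trans ?_
    rw [← Set.ncard_prod, ← Set.InjOn.ncard_image (f := L)
      (hinj.mono (Set.prod_mono_right (Set.sep_subset _ _)))]
    refine Set.ncard_le_ncard ?_ (Set.toFinite _)
    rintro _ ⟨x, ⟨hx1, hx2, hx3⟩, rfl⟩
    exact ⟨⟨x, ⟨hx1, hx2⟩, rfl⟩, by rw [hsnd]; exact hx3⟩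

end Packing

/-! ### Products of 2-spaces from two matched parallelisms. -/

section Middle

theorem finrank_prod_submodule {F V W : Type*} [Field F] [AddCommGroup V] [Module F V]
    [AddCommGroup W] [Module F W] [Module.Finite F V] [Module.Finite F W] (A : Submodule F V)
    (B : Submodule F W) : finrank F ↥(A.prod B) = finrank F A + finrank F B := by
  have h1 : A.prod B = LinearMap.range (A.subtype.prodMap B.subtype) := by
    rw [LinearMap.range_prodMap, range_subtype, range_subtype]
  rw [h1, LinearMap.finrank_range_of_inj (A.injective_subtype.prodMap B.injective_subtype),
    finrank_prod]

/-- Both factors carry the same class index `z`. Different positions on either side, or different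
members of one class, make one factor of the intersection trivial. Different classes at equal
positions give at most `1 + 1`. -/
theorem exists_middle_packing {F : Type v} [Field F] [Finite F] {D E : Type v} [AddCommGroup D]
    [Module F D] [Finite D] [AddCommGroup E] [Module F E] [Finite E] (h : ℕ)
    (hD : finrank F D = 9) (hE : finrank F E = 9 + h) :
    ∃ S : Set (Submodule F (D × E)), IsPacking S ∧
      (∀ X ∈ S, finrank F (X.map (LinearMap.fst F D E)) ≤ 2 ∧
        finrank F (X.map (LinearMap.snd F D E)) ≤ 2) ∧
      S.ncard = ∑ i ∈ Finset.range 3, ∑ j ∈ Finset.range (min 3 ((5 + h) / 2) + 1),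
        Nat.card F ^ (min (7 - 2 * i) (7 + h - 2 * j) + (14 + h - 2 * i - 2 * j)) := by
  have hq : 1 < Nat.card F := Finite.one_lt_card
  set K := min 3 ((5 + h) / 2) + 1 with hK
  obtain ⟨A, hA1, hA2, hA3, hA4⟩ := exists_lines 3 9 D hD (by norm_num)
  -- The cap `(5 + h) / 2` on `j` is what yields `2 * K + 2 ≤ 9 + h`.
  obtain ⟨B, hB1, hB2, hB3, hB4⟩ := exists_lines K (9 + h) E hE (by omega)
  -- The minimum makes `z` a valid class index on both sides.
  let I := Σ i : Fin 3, Σ j : Fin K,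
    Fin (Nat.card F ^ min (9 - 2 * (i : ℕ) - 2) (9 + h - 2 * (j : ℕ) - 2)) ×
      Fin (Nat.card F ^ (9 - 2 * (i : ℕ) - 2)) × Fin (Nat.card F ^ (9 + h - 2 * (j : ℕ) - 2))
  let Y : I → Submodule F (D × E) := fun t =>
    (A t.1 t.2.2.1 t.2.2.2.1).prod (B t.2.1 t.2.2.1 t.2.2.2.2)
  obtain ⟨hpack, hinj⟩ := isPacking_image (s := Set.univ) (X := Y) (by
    rintro ⟨i, j, z, x, x'⟩ -
    rw [finrank_prod_submodule, hA1 _ _ _ i.2, hB1 _ _ _ j.2]) (by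
    rintro ⟨i, j, z, x, x'⟩ - ⟨i', j', w, y, y'⟩ - hne
    dsimp only [Y]
    rw [Submodule.prod_inf_prod, finrank_prod_submodule]
    have hA : finrank F ↥(A i z x ⊓ A i' w y) ≤ 2 :=
      (finrank_mono inf_le_left).trans (hA1 _ _ _ i.2).le
    have hB : finrank F ↥(B j z x' ⊓ B j' w y') ≤ 2 :=
      (finrank_mono inf_le_left).trans (hB1 _ _ _ j.2).le
    have hlt : ∀ {a b : ℕ} (c : Fin (Nat.card F ^ min a b)),
        (c : ℕ) < Nat.card F ^ a ∧ (c : ℕ) < Nat.card F ^ b := fun {a b} c =>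
      ⟨c.2.trans_le (Nat.pow_le_pow_right hq.le (min_le_left a b)),
        c.2.trans_le (Nat.pow_le_pow_right hq.le (min_le_right a b))⟩
    by_cases hi : i = i'
    swap
    · rw [(hA2 _ z x _ w y i.2 i'.2 fun h => hi (Fin.ext h)).eq_bot, finrank_bot]
      omega
    by_cases hj : j = j'
    swap
    · rw [(hB2 _ z x' _ w y' j.2 j'.2 fun h => hj (Fin.ext h)).eq_bot, finrank_bot]
      omega
    subst hi hj
    by_cases hz : z = w
    swap
    · have hz' : (z : ℕ) ≠ w := fun h => hz (Fin.ext h)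
      have h1 := hA4 _ _ _ _ _ i.2 x.2 y.2 (hlt z).1 (hlt w).1 hz'
      have h2 := hB4 _ _ _ _ _ j.2 x'.2 y'.2 (hlt z).2 (hlt w).2 hz'
      omega
    subst hz
    by_cases hx : x = y
    swap
    · rw [(hA3 _ z _ _ i.2 x.2 y.2 fun h => hx (Fin.ext h)).eq_bot, finrank_bot]
      omega
    subst hx
    have hx' : x' ≠ y' := fun h => hne (h ▸ rfl)
    rw [(hB3 _ z _ _ j.2 x'.2 y'.2 fun h => hx' (Fin.ext h)).eq_bot, finrank_bot]
    omega)
  refine ⟨Y '' Set.univ, hpack, ?_, ?_⟩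
  · rintro _ ⟨⟨i, j, z, x, x'⟩, -, rfl⟩
    dsimp only [Y]
    rw [Submodule.prod_map_fst, Submodule.prod_map_snd, hA1 _ _ _ i.2, hB1 _ _ _ j.2]
    exact ⟨le_rfl, le_rfl⟩
  · rw [hinj.ncard_image, Set.ncard_univ, Nat.card_sigma, Finset.sum_range]
    refine Finset.sum_congr rfl fun i _ => ?_
    rw [Nat.card_sigma, Finset.sum_range]
    refine Finset.sum_congr rfl fun j _ => ?_
    rw [Nat.card_prod, Nat.card_prod, Nat.card_fin, Nat.card_fin, Nat.card_fin, ← pow_add,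
      ← pow_add]
    have := i.2
    have := j.2
    congr 1
    omega

end Middle

/-! ### Assembling the four families. -/

section Assembly

variable {F : Type v} [Field F]

/-- Exchange of the two outer parts of a coordinate space. -/
def mirror (F : Type v) [Field F] (E H : Type*) [AddCommGroup E] [Module F E] [AddCommGroup H]
    [Module F H] : ((E × F) × (H × (F × E))) ≃ₗ[F] ((E × F) × (H × (F × E))) where
  toFun v := ((v.2.2.2, v.2.2.1), (v.2.1, (v.1.2, v.1.1)))
  invFun v := ((v.2.2.2, v.2.2.1), (v.2.1, (v.1.2, v.1.1)))
  map_add' _ _ := rfl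
  map_smul' _ _ := rfl
  left_inv _ := rfl
  right_inv _ := rfl

theorem lifted_count_cast {q m : ℕ} (hq : 1 < q) :
    (((1 + (q ^ m - 1) * ((q ^ 2 + 1) * (q ^ 2 + q + 1)) : ℕ)) : ℤ) =
      1 + ((q : ℤ) ^ m - 1) * ((q : ℤ) ^ 2 + 1) * ((q : ℤ) ^ 2 + q + 1) := by
  push_cast [Nat.one_le_pow m q (by omega)]
  ring

theorem cdcBound_le_maxCDC [Finite F] (h : ℕ) (C : Set (Submodule F (Fin 8 → F)))
    (hC : IsCDC 8 4 4 C) : cdcBound (Nat.card F) h C.ncard ≤ (maxCDC F (18 + h) 4 4 : ℤ) := by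
  have hq : 1 < Nat.card F := Finite.one_lt_card
  obtain ⟨hCne, hC4, hCd⟩ := hC
  obtain ⟨T, hT3, hT1, hTC, hTcard⟩ := exists_greedy_threeSpaces C hC4
  let E := Fin 8 → F
  let H := Fin h → F
  let V := (E × F) × (H × (F × E))
  have hCpack : IsPacking C := ⟨hC4, fun X hX Y hY hne => by
    have h1 := finrank_sup_add_finrank_inf_eq X Y
    have h2 := hCd X hX Y hY hne
    rw [hC4 X hX, hC4 Y hY] at h1
    rw [subspaceDist] at h2
    omega⟩
  obtain ⟨hTpack, hTinj⟩ := isPacking_image (s := T)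
    (X := fun W => W.prod (⊤ : Submodule F F)) (by
      intro W hW
      rw [finrank_prod_submodule, hT3 W hW, finrank_top, finrank_self]) (by
      intro W hW W' hW' hne
      rw [Submodule.prod_inf_prod, finrank_prod_submodule, inf_idem, finrank_top, finrank_self]
      have := hT1 W hW W' hW' hne
      omega)
  obtain ⟨S₁, hS₁, hS₁U, hS₁card, hS₁low⟩ := exists_lifted_packing (V := V) (m := 10 + h)
    (LinearEquiv.prodAssoc F E F (H × (F × E))).symm (by simp [E, H]; omega) (by omega) hCpack
  obtain ⟨S₂, hS₂, hS₂U, hS₂card, hS₂low⟩ := exists_lifted_packing (V := V) (m := 9 + h)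
    (LinearEquiv.refl F V) (by simp [E, H]; omega) (by omega) hTpack
  rw [hTinj.ncard_image] at hS₂card hS₂low
  obtain ⟨Y, hY, hYmap, hYcard⟩ := exists_middle_packing (F := F) (D := E × F)
    (E := H × (F × E)) h (by simp [E]) (by simp [E, H]; omega)
  let π : V →ₗ[F] E × F := LinearMap.fst F _ _
  let R : V ≃ₗ[F] V := mirror F E H
  let σ : V →ₗ[F] E × F := π ∘ₗ R.toLinearMap
  have hσ : ∀ X : Submodule F V, (X.map R.toLinearMap).map π = X.map σ := fun X =>
    (Submodule.map_comp _ _ _).symm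
  have hdis₁ : ∀ X ∈ S₁, Disjoint X (LinearMap.ker π) := fun X hX =>
    (hS₁U X hX).1.mono_right fun v (hv : v.1 = 0) => congrArg Prod.fst hv
  have hdis₂ : ∀ X ∈ S₂, Disjoint X (LinearMap.ker π) := fun X hX => (hS₂U X hX).1
  have hσ₁ : ∀ X : Submodule F V, finrank F (X.map σ) ≤ finrank F (X.map
      (LinearMap.snd F E (F × (H × (F × E))) ∘ₗ
        (LinearEquiv.prodAssoc F E F (H × (F × E))).symm.symm.toLinearMap)) := by
    intro X
    let τ : (F × (H × (F × E))) →ₗ[F] E × F :=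
      { toFun := fun v => (v.2.2.2, v.2.2.1), map_add' := fun _ _ => rfl, map_smul' := fun _ _ => rfl }
    rw [show σ = τ ∘ₗ (LinearMap.snd F E (F × (H × (F × E))) ∘ₗ
        (LinearEquiv.prodAssoc F E F (H × (F × E))).symm.symm.toLinearMap) from rfl,
      Submodule.map_comp _ τ]
    exact finrank_map_le _ _
  have hσ₂ : ∀ X : Submodule F V, finrank F (X.map σ) ≤ finrank F (X.map
      (LinearMap.snd F (E × F) (H × (F × E)))) := by
    intro X
    let τ : (H × (F × E)) →ₗ[F] E × F :=
      { toFun := fun v => (v.2.2, v.2.1), map_add' := fun _ _ => rfl, map_smul' := fun _ _ => rfl }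
    rw [show σ = τ ∘ₗ LinearMap.snd F (E × F) (H × (F × E)) from rfl, Submodule.map_comp]
    exact finrank_map_le _ _
  have h₁₂ : ∀ X ∈ S₁, ∀ Z ∈ S₂, finrank F ↥(X ⊓ Z) ≤ 2 := by
    intro X hX Z hZ
    obtain ⟨hd, hU⟩ := hS₁U X hX
    obtain ⟨W, hW, hWZ⟩ := (hS₂U Z hZ).2
    -- Project to `E`: there `X` becomes a member of `C`, and `Z` falls inside some `W` of `T` not
    -- contained in it.
    refine (finrank_inf_le_map_inf_map hd Z).trans
      ((finrank_mono ?_).trans (hTC W hW _ hU))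
    rw [inf_comm]
    refine inf_le_inf_right _ ?_
    rintro _ ⟨z, hz, rfl⟩
    have : z.1 ∈ W.prod (⊤ : Submodule F F) := hWZ.symm.le ⟨z, hz, rfl⟩
    exact this.1
  let S := S₁ ∪ S₂
  have hS : IsPacking S := hS₁.union hS₂ h₁₂
  have hSdis : ∀ X ∈ S, Disjoint X (LinearMap.ker π) := fun X hX =>
    hX.elim (hdis₁ X) (hdis₂ X)
  let Low := {X | X ∈ S ∧ finrank F (X.map σ) ≤ 2}
  have hLow : IsPacking Low := hS.subset (Set.sep_subset _ _)
  let Z := Submodule.map R.toLinearMap '' Low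
  have hZ : IsPacking Z := hLow.map_equiv R
  have hSZ : ∀ X ∈ S, ∀ X' ∈ Z, finrank F ↥(X ⊓ X') ≤ 2 := by
    rintro X hX _ ⟨X', hX', rfl⟩
    refine (finrank_inf_le_finrank_map (hSdis X hX) _).trans ?_
    rw [hσ]
    exact hX'.2
  have hSY : ∀ X ∈ S, ∀ X' ∈ Y, finrank F ↥(X ⊓ X') ≤ 2 := fun X hX X' hX' =>
    (finrank_inf_le_finrank_map (hSdis X hX) _).trans (hYmap X' hX').1
  have hZY : ∀ X ∈ Z, ∀ X' ∈ Y, finrank F ↥(X ⊓ X') ≤ 2 := by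
    rintro _ ⟨X, hX, rfl⟩ X' hX'
    have hd : Disjoint (X.map R.toLinearMap) (LinearMap.ker σ) := by
      rw [Submodule.disjoint_def]
      rintro _ ⟨v, hv, rfl⟩ hv0
      -- The exchange `R` is an involution, so `σ` of the mirrored vector is `π v`.
      have : v = 0 := Submodule.disjoint_def.1 (hSdis X hX.1) v hv hv0
      rw [this, map_zero]
    exact (finrank_inf_le_finrank_map hd _).trans ((hσ₂ X').trans (hYmap X' hX').2)
  have hSZY : ∀ X ∈ S ∪ Z, ∀ X' ∈ Y, finrank F ↥(X ⊓ X') ≤ 2 := fun X hX X' hX' =>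
    hX.elim (fun hX => hSY X hX X' hX') (fun hX => hZY X hX X' hX')
  have hLowcard : C.ncard * (1 + (Nat.card F ^ (10 + h) - 1) *
        ((Nat.card F ^ 2 + 1) * (Nat.card F ^ 2 + Nat.card F + 1))) +
      T.ncard * (1 + (Nat.card F ^ (9 + h) - 1) *
        ((Nat.card F ^ 2 + 1) * (Nat.card F ^ 2 + Nat.card F + 1))) ≤ Low.ncard := by
    refine (Nat.add_le_add hS₁low hS₂low).trans ?_
    rw [← Set.ncard_union_eq ((hS₁.disjoint h₁₂).mono (Set.sep_subset _ _) (Set.sep_subset _ _))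
      (Set.toFinite _) (Set.toFinite _)]
    refine Set.ncard_le_ncard ?_ (Set.toFinite _)
    rintro X (⟨hX, hX2⟩ | ⟨hX, hX2⟩)
    · exact ⟨Or.inl hX, (hσ₁ X).trans hX2⟩
    · exact ⟨Or.inr hX, (hσ₂ X).trans hX2⟩
  have hall : IsPacking (S ∪ Z ∪ Y) := (hS.union hZ hSZ).union hY hSZY
  have htotal : (S ∪ Z ∪ Y).ncard = S₁.ncard + S₂.ncard + Low.ncard + Y.ncard := by
    rw [(hS.union hZ hSZ).ncard_union hSZY, hS.ncard_union hSZ, hS₁.ncard_union h₁₂,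
      ncard_image_map_equiv]
  have hCpos : 0 < C.ncard := (Set.ncard_pos (Set.toFinite _)).2 hCne
  have hne : (S ∪ Z ∪ Y).Nonempty := by
    refine Set.nonempty_of_ncard_ne_zero ?_
    have : 0 < C.ncard * Nat.card F ^ (3 * (10 + h)) := by positivity
    omega
  have hmax := le_maxCDC_of_isPacking hall hne (n := 18 + h) (by simp [V, E, H]; omega)
  have hmain : C.ncard * Nat.card F ^ (3 * (10 + h)) + T.ncard * Nat.card F ^ (3 * (9 + h)) +
      (C.ncard * (1 + (Nat.card F ^ (10 + h) - 1) *
        ((Nat.card F ^ 2 + 1) * (Nat.card F ^ 2 + Nat.card F + 1))) +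
      T.ncard * (1 + (Nat.card F ^ (9 + h) - 1) *
        ((Nat.card F ^ 2 + 1) * (Nat.card F ^ 2 + Nat.card F + 1)))) + Y.ncard ≤
      maxCDC F (18 + h) 4 4 := by omega
  rw [hYcard] at hmain
  have hmain' := (Nat.cast_le (α := ℤ)).2 hmain
  rw [Nat.cast_add, Nat.cast_add, Nat.cast_add, Nat.cast_add, Nat.cast_mul, Nat.cast_mul,
    Nat.cast_mul, Nat.cast_mul, lifted_count_cast hq, lifted_count_cast hq] at hmain'
  push_cast at hmain'
  -- The coefficients of `T.ncard` are nonnegative, so it may be replaced by its lower bound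
  -- `greedyCount`.
  have hA : (0 : ℤ) ≤ (Nat.card F : ℤ) ^ (27 + 3 * h) := by positivity
  have hB : (0 : ℤ) ≤ 1 + ((Nat.card F : ℤ) ^ (9 + h) - 1) * ((Nat.card F : ℤ) ^ 2 + 1) *
      ((Nat.card F : ℤ) ^ 2 + Nat.card F + 1) := by
    rw [← lifted_count_cast hq]
    positivity
  have hA' := mul_le_mul_of_nonneg_right hTcard hA
  have hB' := mul_le_mul_of_nonneg_right hTcard hB
  rw [show 3 * (10 + h) = 30 + 3 * h by ring, show 3 * (9 + h) = 27 + 3 * h by ring] at hmain'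
  rw [cdcBound]
  linarith

end Assembly

/-- The supremum is attained: a single `k`-space is already a code, and sizes are bounded by the
number of subspaces. -/
theorem exists_isCDC_ncard_eq_maxCDC (F : Type*) [Field F] [Finite F] {n d k : ℕ} (hk : k ≤ n) :
    ∃ C : Set (Submodule F (Fin n → F)), IsCDC n d k C ∧ C.ncard = maxCDC F n d k := by
  refine Nat.sSup_mem (s := {M | ∃ C : Set (Submodule F (Fin n → F)),
    IsCDC n d k C ∧ C.ncard = M}) ?_ ⟨Nat.card (Submodule F (Fin n → F)), ?_⟩
  · have hli := (Pi.basisFun F (Fin n)).linearIndependent.comp _ (Fin.castLE_injective hk)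
    obtain ⟨W, hW⟩ : ∃ W : Submodule F (Fin n → F), finrank F W = k :=
      ⟨_, (finrank_span_eq_card hli).trans (Fintype.card_fin k)⟩
    refine ⟨_, {W}, ⟨⟨W, rfl⟩, ?_, ?_⟩, rfl⟩
    · rintro _ rfl
      exact hW
    · rintro _ rfl _ rfl hne
      exact absurd rfl hne
  · rintro _ ⟨C, -, rfl⟩
    exact Set.ncard_le_card C

theorem mainTheorem7 (F : Type*) [Field F] [Finite F] (q : ℕ) (hq : Nat.card F = q) (h : ℕ) :
    cdcBound q h (maxCDC F 8 4 4) ≤ (maxCDC F (18 + h) 4 4 : ℤ) ∧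
    ∀ C : Set (Submodule F (Fin 8 → F)), IsCDC 8 4 4 C →
      cdcBound q h C.ncard ≤ (maxCDC F (18 + h) 4 4 : ℤ) := by
  subst hq
  refine ⟨?_, fun C hC => cdcBound_le_maxCDC h C hC⟩
  obtain ⟨C, hC, hcard⟩ := exists_isCDC_ncard_eq_maxCDC F (n := 8) (d := 4) (k := 4) (by norm_num)
  rw [← hcard]
  exact cdcBound_le_maxCDC h C hC
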